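/- Let $p$ be a prime, $k$ an algebraically closed field of characteristic $p$, and $G=\mathrm{SL}_2(\mathbb F_p)$. For $n\ge 1$ let $V_n$ be the $n$-dimensional $kG$-module of homogeneous polynomials over $k$ of degree $n-1$ in two variables $X,Y$, with action $\begin{pmatrix} a&b\\ c&d\end{pmatrix} f(X,Y)=f(aX+cY,\,bX+dY)$. Suppose $1\le i,j,l\le p-1$. Then the following are equivalent (where a module is called a summand of another if it is isomorphic to a direct summand of it, as $kG$-modules): (i) $V_l$ is a summand of $V_i\otimes V_j$; (ii) $V_i$ is a summand of $V_j\otimes V_l$; (iii) $V_j$ is a summand of $V_l\otimes V_i$; (iv) $i+j+l\equiv 1 \pmod 2$, $i+j+l<2p$, and $l<i+j$, $i<j+l$ and $j<l+i$. Moreover, for each $n$ with $1\le n\le p-1$, let $A^{(n)}$ be the $(p-1)\times(p-1)$ matrix whose $(i,j)$ entry, for $1\le i,j\le p-1$, is the multiplicity of $V_j$ as an indecomposable summand of $V_i\otimes V_n$, i.e. the number of summands isomorphic to $V_j$ in a decomposition of $V_i\otimes V_n$ into indecomposable $kG$-modules. Then $A^{(n)}$ is a symmetric matrix. -/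

import Mathlib

namespace SL2Mod

open MvPolynomial

/-- The group `G = SL₂(𝔽_p)`. -/
abbrev G (p : ℕ) : Type := Matrix.SpecialLinearGroup (Fin 2) (ZMod p)

section Action

variable (p : ℕ) (k : Type*) [Field k] [CharP k p]

/-- The substitution attached to `g = !![a, b; c, d]`: the `k`-algebra endomorphism
`f(X, Y) ↦ f(aX + cY, bX + dY)` of `k[X, Y]`, where `X = X 0`, `Y = X 1` and the entries of `g`
are read in `k` through the inclusion of the prime field. -/
noncomputable def subst (g : G p) : MvPolynomial (Fin 2) k →ₐ[k] MvPolynomial (Fin 2) k :=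
  aeval ![C (ZMod.castHom (dvd_refl p) k (g 0 0)) * X 0 +
            C (ZMod.castHom (dvd_refl p) k (g 1 0)) * X 1,
          C (ZMod.castHom (dvd_refl p) k (g 0 1)) * X 0 +
            C (ZMod.castHom (dvd_refl p) k (g 1 1)) * X 1]

theorem subst_one : subst p k 1 = AlgHom.id k _ := by
  apply MvPolynomial.algHom_ext
  intro i
  fin_cases i <;> simp [subst]

theorem subst_mul (g h : G p) : subst p k (g * h) = (subst p k g).comp (subst p k h) := by
  apply MvPolynomial.algHom_ext
  intro i
  fin_cases i <;>
    (simp only [subst, Matrix.SpecialLinearGroup.coe_mul, Matrix.mul_apply, Fin.sum_univ_two,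
      map_add, map_mul, aeval_X, AlgHom.comp_apply, Fin.zero_eta, Fin.mk_one, Fin.isValue,
      Matrix.cons_val_zero, Matrix.cons_val_one, algHom_C, algebraMap_eq]
     ring)

theorem subst_mem (g : G p) (m : ℕ) (f : MvPolynomial (Fin 2) k)
    (hf : f ∈ homogeneousSubmodule (Fin 2) k m) :
    subst p k g f ∈ homogeneousSubmodule (Fin 2) k m := by
  rw [mem_homogeneousSubmodule] at hf ⊢
  rw [← one_mul m]
  refine hf.eval₂ _ _ (fun r => isHomogeneous_C _ r) fun i => ?_
  fin_cases i <;>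
    exact (isHomogeneous_C_mul_X _ _).add (isHomogeneous_C_mul_X _ _)

/-- For `n ≥ 1`, the `kG`-module `V_n` of homogeneous polynomials of degree `n - 1` in two
variables over `k`, with `!![a, b; c, d] • f(X, Y) = f(aX + cY, bX + dY)`.
(It is only used for `n ≥ 1`.) -/
noncomputable def V (n : ℕ) :
    Representation k (G p) (homogeneousSubmodule (Fin 2) k (n - 1)) where
  toFun g := (subst p k g).toLinearMap.restrict (subst_mem p k g (n - 1))
  map_one' := by
    ext f : 2
    simp [subst_one]
  map_mul' g h := by
    ext f : 2
    exact congrArg (fun φ => φ f.1) (subst_mul p k g h)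

end Action

section Summands

variable {k H M N : Type*} [Field k] [Monoid H] [AddCommMonoid M] [Module k M]
  [AddCommMonoid N] [Module k N]

/-- `σ` is indecomposable: it is nonzero, and whenever it is the internal direct sum of two
subrepresentations, one of them is zero. -/
def IsIndecomposable (σ : Representation k H N) : Prop :=
  Nontrivial N ∧ ∀ A B : Subrepresentation σ, IsCompl A B → A = ⊥ ∨ B = ⊥

/-- `ρ` is (isomorphic to) a direct summand of `σ`. -/
def IsSummand (ρ : Representation k H M) (σ : Representation k H N) : Prop :=
  ∃ A B : Subrepresentation σ, IsCompl A B ∧ Nonempty (ρ.Equiv A.toRepresentation)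

/-- In some decomposition of `σ` as a finite internal direct sum of indecomposable
subrepresentations, exactly `m` of the summands are isomorphic to `ρ`. -/
def OccursExactly (ρ : Representation k H M) (σ : Representation k H N) (m : ℕ) : Prop :=
  ∃ (r : ℕ) (W : Fin r → Subrepresentation σ),
    DirectSum.IsInternal (fun x => (W x).toSubmodule) ∧
    (∀ x, IsIndecomposable (W x).toRepresentation) ∧
    {x | Nonempty (ρ.Equiv (W x).toRepresentation)}.ncard = m

/-- The multiplicity of `ρ` as an indecomposable summand of a finite-dimensional representation
`σ`: the number of summands isomorphic to `ρ` in a decomposition of `σ` into indecomposables.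
By Krull–Schmidt this number exists and does not depend on the decomposition, so the
set below has exactly one element, and `sSup` picks it out. -/
noncomputable def summandMultiplicity (ρ : Representation k H M) (σ : Representation k H N) : ℕ :=
  sSup {m | OccursExactly ρ σ m}

end Summands

/-- The matrix `A^{(n)}`, with rows and columns indexed by `1, …, p - 1`, whose `(i, j)` entry is
the multiplicity of `V_j` as an indecomposable summand of `V_i ⊗ V_n`. -/
noncomputable def multMatrix (p : ℕ) (k : Type*) [Field k] [CharP k p] (n : ℕ) :
    Matrix (Finset.Icc 1 (p - 1)) (Finset.Icc 1 (p - 1)) ℕ :=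
  Matrix.of fun i j => summandMultiplicity (V p k j) ((V p k i).tprod (V p k n))

end SL2Mod

/-! For `1 ≤ n ≤ p` the module `V_n` is a brick: its only endomorphisms are scalars. For a brick
`ρ`, the rank of the composition pairing `Hom(ρ, σ) × Hom(σ, ρ) → End ρ = k` is additive in `σ`,
equals 1 on `ρ`, and vanishes on every other indecomposable. Hence it is the multiplicity of `ρ` in
any decomposition of `σ`, and it is nonzero exactly when `ρ` is a summand. This makes multiplicities
computable without a general Krull–Schmidt theorem.

Fix `l` and let `N i j` be the multiplicity of `V_l` in `V_i ⊗ V_j`, with `V_0 = 0`. If `n` is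
invertible in `k`, then `V_2 ⊗ V_n ≅ V_(n+1) ⊕ V_(n-1)`. Expanding `V_2 ⊗ V_i ⊗ V_j` through either
factor gives `N (i+1) j + N (i-1) j = N i (j+1) + N i (j-1)` for `1 ≤ i, j < p`. The boundary values
are `N 0 j = N i 0 = 0`, `N 1 j = δ_(jl)` and `N i p = 0`. The last holds by a trace argument: `V_p`
is a brick whose dimension is zero in `k`, while `dim V_l` is invertible.

The recursion and boundary values determine `N`, and the indicator function of condition (iv)
satisfies both (`eq_fusionRule_of_recursion`). So every multiplicity is 0 or 1, given by a condition
symmetric in `i, j, l`. Both the equivalences and the symmetry of `A^{(n)}` follow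
(`pairingRank_V_tprod`). -/

namespace SL2Mod

open Representation

/-! ### Multiplicities of bricks through the composition pairing -/

section Multiplicity

variable {k H : Type*} [Field k] [Monoid H]

/-- A splitting of `σ` as a finite direct sum of the representations `τ x`, given by inclusions and
projections. -/
structure Splitting {M : Type*} [AddCommGroup M] [Module k M] (σ : Representation k H M)
    {ι : Type*} [Fintype ι] {W : ι → Type*} [∀ x, AddCommGroup (W x)] [∀ x, Module k (W x)]
    (τ : ∀ x, Representation k H (W x)) where
  incl (x : ι) : (τ x).IntertwiningMap σ
  proj (x : ι) : σ.IntertwiningMap (τ x)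
  proj_incl (x : ι) (w : W x) : proj x (incl x w) = w
  proj_incl_ne (x y : ι) (w : W y) : x ≠ y → proj x (incl y w) = 0
  sum_incl_proj (v : M) : ∑ x, incl x (proj x v) = v

variable {S M N : Type*} [AddCommGroup S] [Module k S] [AddCommGroup M] [Module k M]
  [AddCommGroup N] [Module k N]
  (ρ : Representation k H S) (σ : Representation k H M) (τ : Representation k H N)

/-- The intertwining maps `ρ → σ` that compose to zero with every intertwining map `σ → ρ`. -/
def negligible : Submodule k (ρ.IntertwiningMap σ) where
  carrier := {α | ∀ β : σ.IntertwiningMap ρ, ∀ s, β (α s) = 0}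
  add_mem' {a b} ha hb β s := by simp [ha β s, hb β s]
  zero_mem' β s := by simp
  smul_mem' c a ha β s := by simp [ha β s]

/-- The rank of the composition pairing between `Hom(ρ, σ)` and `Hom(σ, ρ)`. -/
noncomputable def pairingRank : ℕ := Module.finrank k (ρ.IntertwiningMap σ ⧸ negligible ρ σ)

variable {ρ σ τ}

lemma mem_negligible {α : ρ.IntertwiningMap σ} :
    α ∈ negligible ρ σ ↔ ∀ β : σ.IntertwiningMap ρ, ∀ s, β (α s) = 0 := Iff.rfl

lemma pairingRank_ne_zero [FiniteDimensional k S] [FiniteDimensional k M] :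
    pairingRank ρ σ ≠ 0 ↔
      ∃ (α : ρ.IntertwiningMap σ) (β : σ.IntertwiningMap ρ) (s : S), β (α s) ≠ 0 := by
  rw [pairingRank, ← Nat.pos_iff_ne_zero, Module.finrank_pos_iff,
    Submodule.Quotient.nontrivial_iff, Ne, Submodule.eq_top_iff']
  simp [mem_negligible]

namespace Splitting

variable {ι : Type*} [Fintype ι] {W : ι → Type*} [∀ x, AddCommGroup (W x)]
    [∀ x, Module k (W x)] {θ : ∀ x, Representation k H (W x)}

/-- Intertwining maps into a direct sum are families of intertwining maps. -/
noncomputable def homEquiv (D : Splitting σ θ) (ρ : Representation k H S) :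
    ρ.IntertwiningMap σ ≃ₗ[k] ∀ x, ρ.IntertwiningMap (θ x) where
  toFun α x := (D.proj x).comp α
  invFun f := ∑ x, (D.incl x).comp (f x)
  map_add' a b := by ext; simp
  map_smul' c a := by ext; simp
  left_inv α := by
    refine IntertwiningMap.ext (LinearMap.ext fun s => ?_)
    simp [IntertwiningMap.toLinearMap_sum, D.sum_incl_proj]
  right_inv f := by
    ext x s
    simp only [IntertwiningMap.comp_apply, IntertwiningMap.sum_apply,
      IntertwiningMap.coe_toLinearMap, map_sum]
    rw [Finset.sum_eq_single x, D.proj_incl]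
    · intro y _ hy
      exact D.proj_incl_ne x y _ hy.symm
    · simp

/-- Maps out of a summand extend to `σ` through the projection, and maps out of `σ` restrict along
the inclusion, so negligibility can be tested componentwise. -/
lemma map_negligible (D : Splitting σ θ) (ρ : Representation k H S) :
    (negligible ρ σ).map (D.homEquiv ρ).toLinearMap =
      Submodule.pi Set.univ fun x => negligible ρ (θ x) := by
  ext f
  simp only [Submodule.mem_map, Submodule.mem_pi, Set.mem_univ, forall_const]
  constructor
  · rintro ⟨α, hα, rfl⟩ x β s
    exact hα (β.comp (D.proj x)) s
  · intro hf
    refine ⟨(D.homEquiv ρ).symm f, fun β s => ?_, (D.homEquiv ρ).apply_symm_apply f⟩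
    have : (D.homEquiv ρ).symm f s = ∑ x, D.incl x (f x s) := by
      rw [← IntertwiningMap.toLinearMap_apply]
      simp [homEquiv, IntertwiningMap.toLinearMap_sum]
    rw [this, map_sum]
    exact Finset.sum_eq_zero fun x _ => hf x (β.comp (D.incl x)) s

lemma pairingRank_eq (D : Splitting σ θ) (ρ : Representation k H S) [FiniteDimensional k S]
    [∀ x, FiniteDimensional k (W x)] : pairingRank ρ σ = ∑ x, pairingRank ρ (θ x) := by
  classical
  rw [pairingRank, (Submodule.Quotient.equiv _ _ (D.homEquiv ρ) (D.map_negligible ρ)).finrank_eq,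
    (Submodule.quotientPi _).finrank_eq, Module.finrank_pi_fintype]
  rfl

end Splitting

/-- A splitting with a single summand. -/
def Splitting.ofEquiv (e : σ.Equiv τ) : Splitting σ (fun _ : Unit => τ) where
  incl _ := e.symm.toIntertwiningMap
  proj _ := e.toIntertwiningMap
  proj_incl _ w := e.apply_symm_apply w
  proj_incl_ne x y := by simp
  sum_incl_proj v := by simp

lemma pairingRank_congr (ρ : Representation k H S) [FiniteDimensional k S] [FiniteDimensional k N]
    (e : σ.Equiv τ) : pairingRank ρ σ = pairingRank ρ τ := by
  simpa using (Splitting.ofEquiv e).pairingRank_eq ρ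

/-- `ρ` is nonzero and its only endomorphisms are the scalars. -/
def IsBrick (ρ : Representation k H S) : Prop :=
  Nontrivial S ∧ ∀ f : ρ.IntertwiningMap ρ, ∃ c : k, ∀ s, f s = c • s

lemma isCompl_toSubmodule {A B : Subrepresentation σ} (h : IsCompl A B) :
    IsCompl A.toSubmodule B.toSubmodule :=
  IsCompl.of_eq (congrArg Subrepresentation.toSubmodule h.inf_eq_bot)
    (congrArg Subrepresentation.toSubmodule h.sup_eq_top)

lemma isCompl_of_toSubmodule {A B : Subrepresentation σ}
    (h : IsCompl A.toSubmodule B.toSubmodule) : IsCompl A B :=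
  IsCompl.of_eq (Subrepresentation.toSubmodule_injective h.inf_eq_bot)
    (Subrepresentation.toSubmodule_injective h.sup_eq_top)

/-- The inclusion of a subrepresentation. -/
def inclusionMap (A : Subrepresentation σ) : A.toRepresentation.IntertwiningMap σ where
  toLinearMap := A.toSubmodule.subtype
  isIntertwining' _ := rfl

@[simp] lemma inclusionMap_apply (A : Subrepresentation σ) (a : A.toSubmodule) :
    inclusionMap A a = a := rfl

/-- The projection onto a subrepresentation along a complement. -/
noncomputable def projectionMap {A B : Subrepresentation σ} (h : IsCompl A B) :
    σ.IntertwiningMap A.toRepresentation where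
  toLinearMap := A.toSubmodule.projectionOnto _ (isCompl_toSubmodule h)
  isIntertwining' g := by
    ext v
    obtain ⟨a, b, ha, hb, rfl⟩ := Submodule.codisjoint_iff_exists_add_eq.1
      (isCompl_toSubmodule h).codisjoint v
    have h1 : ∀ a ∈ A.toSubmodule, (A.toSubmodule.projectionOnto _ (isCompl_toSubmodule h) a).1 = a :=
      fun a ha => congrArg Subtype.val
        (Submodule.projectionOnto_apply_of_mem_left (isCompl_toSubmodule h) ha)
    have h2 : ∀ b ∈ B.toSubmodule, A.toSubmodule.projectionOnto _ (isCompl_toSubmodule h) b = 0 :=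
      fun b hb => (Submodule.projectionOnto_apply_eq_zero_iff (isCompl_toSubmodule h)).2 hb
    simp only [LinearMap.comp_apply, map_add, h2 b hb, h2 _ (B.apply_mem_toSubmodule g hb), add_zero,
      h1 _ (A.apply_mem_toSubmodule g ha)]
    rw [map_zero, add_zero]
    exact congrArg (σ g) (h1 a ha).symm

lemma projectionMap_left {A B : Subrepresentation σ} (h : IsCompl A B) (a : A.toSubmodule) :
    projectionMap h a = a :=
  Submodule.projectionOnto_apply_left (isCompl_toSubmodule h) a

lemma projectionMap_right {A B : Subrepresentation σ} (h : IsCompl A B) {b : M}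
    (hb : b ∈ B.toSubmodule) : projectionMap h b = 0 :=
  Submodule.projectionOnto_apply_right (isCompl_toSubmodule h) ⟨b, hb⟩

/-- The projection onto `A` along `B` is an endomorphism, hence a scalar. It is the identity on `A`
and zero on `B`, so one of the two must vanish. -/
lemma IsBrick.isIndecomposable (h : IsBrick ρ) : IsIndecomposable ρ := by
  refine ⟨h.1, fun A B hAB => ?_⟩
  obtain ⟨c, hc⟩ := h.2 ((inclusionMap A).comp (projectionMap hAB))
  have hA : ∀ a ∈ A.toSubmodule, a = c • a := fun a ha => by
    rw [← hc]
    exact (congrArg Subtype.val (projectionMap_left hAB ⟨a, ha⟩)).symm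
  have hB : ∀ b ∈ B.toSubmodule, c • b = 0 := fun b hb => by
    rw [← hc]
    exact congrArg Subtype.val (projectionMap_right hAB hb)
  by_cases h0 : c = 0
  · left
    exact Subrepresentation.toSubmodule_injective
      ((Submodule.eq_bot_iff _).2 fun a ha => by rw [hA a ha, h0, zero_smul])
  · right
    exact Subrepresentation.toSubmodule_injective
      ((Submodule.eq_bot_iff _).2 fun b hb => (smul_eq_zero.1 (hB b hb)).resolve_left h0)

/-- A nonzero composite `β ∘ α` is an invertible scalar `c`, so `c⁻¹ β` retracts `α` and `σ` is the
direct sum of the image of `α` and the kernel of `β`. -/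
lemma IsBrick.isSummand_iff [FiniteDimensional k S] [FiniteDimensional k M] (h : IsBrick ρ) :
    IsSummand ρ σ ↔ pairingRank ρ σ ≠ 0 := by
  rw [pairingRank_ne_zero]
  constructor
  · rintro ⟨A, B, hAB, ⟨e⟩⟩
    have := h.1
    obtain ⟨s, hs⟩ := exists_ne (0 : S)
    refine ⟨(inclusionMap A).comp e.toIntertwiningMap,
      e.symm.toIntertwiningMap.comp (projectionMap hAB), s, ?_⟩
    rw [← show e.symm (projectionMap hAB (e s).1) = s by
      rw [projectionMap_left, e.symm_apply_apply]] at hs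
    exact hs
  · rintro ⟨α, β, s, hs⟩
    obtain ⟨c, hc⟩ := h.2 (β.comp α)
    have hc0 : c ≠ 0 := by
      rintro rfl
      exact hs (by simpa using hc s)
    have hα : Function.Injective α := by
      intro a b hab
      have := hc a
      rw [IntertwiningMap.comp_apply, hab, ← IntertwiningMap.comp_apply, hc b] at this
      exact (smul_right_injective S hc0 this).symm
    refine ⟨α.range, β.ker, isCompl_of_toSubmodule (IsCompl.of_eq ?_ ?_), ⟨Representation.Equiv.mk
      (LinearEquiv.ofInjective α.toLinearMap hα) fun g => ?_⟩⟩
    · rw [Submodule.eq_bot_iff]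
      rintro _ ⟨⟨a, rfl⟩, ha⟩
      have h1 : c • a = 0 := (hc a).symm.trans ha
      rw [(smul_eq_zero.1 h1).resolve_left hc0, map_zero]
    · rw [Submodule.eq_top_iff']
      intro v
      have h1 : β (α (c⁻¹ • β v)) = β v := by
        rw [← IntertwiningMap.comp_apply, hc, smul_inv_smul₀ hc0]
      rw [← add_sub_cancel (α (c⁻¹ • β v)) v]
      refine Submodule.add_mem_sup ⟨_, rfl⟩ ?_
      change β _ = 0
      rw [map_sub, h1, sub_self]
    · ext s
      exact α.isIntertwining _ _ g s

lemma IsBrick.pairingRank_self [FiniteDimensional k S] (h : IsBrick ρ) : pairingRank ρ ρ = 1 := by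
  have := h.1
  have h0 : negligible ρ ρ = ⊥ := by
    rw [eq_bot_iff]
    intro α hα
    exact IntertwiningMap.ext (LinearMap.ext fun s => hα (IntertwiningMap.id ρ) s)
  have h1 : (IntertwiningMap.id ρ) ≠ 0 := by
    intro h0
    obtain ⟨s, hs⟩ := exists_ne (0 : S)
    exact hs (congrArg (fun f : ρ.IntertwiningMap ρ => f s) h0)
  rw [pairingRank, h0, (Submodule.quotEquivOfEqBot _ rfl).finrank_eq]
  refine finrank_eq_one (IntertwiningMap.id ρ) h1 fun f => ?_
  obtain ⟨c, hc⟩ := h.2 f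
  exact ⟨c, IntertwiningMap.ext (LinearMap.ext fun s => (hc s).symm)⟩

/-- A nonzero pairing would split `ρ` off `σ`, and an indecomposable `σ` would then be all of `ρ`.
-/
lemma IsBrick.pairingRank_of_isIndecomposable [FiniteDimensional k S] [FiniteDimensional k M]
    (h : IsBrick ρ) (hσ : IsIndecomposable σ) (hne : ¬ Nonempty (ρ.Equiv σ)) :
    pairingRank ρ σ = 0 := by
  by_contra h0
  obtain ⟨A, B, hAB, ⟨e⟩⟩ := h.isSummand_iff.2 h0
  have := h.1
  rcases hσ.2 A B hAB with rfl | rfl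
  · obtain ⟨s, hs⟩ := exists_ne (0 : S)
    refine hs (e.toLinearEquiv.injective ?_)
    rw [map_zero]
    exact Subtype.ext ((Submodule.mem_bot k).1 (e s).2)
  · have hA : A = ⊤ := by simpa using hAB.sup_eq_top
    subst hA
    exact hne ⟨e.trans (Representation.Equiv.mk Submodule.topEquiv fun g => rfl)⟩

section Internal

variable {r : ℕ} {W : Fin r → Subrepresentation σ}
  (hW : DirectSum.IsInternal (fun x => (W x).toSubmodule))

/-- The linear equivalence given by an internal direct sum decomposition. -/
noncomputable def internalEquiv : (DirectSum (Fin r) fun x => (W x).toSubmodule) ≃ₗ[k] M :=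
  LinearEquiv.ofBijective (DirectSum.coeLinearMap fun x => (W x).toSubmodule) hW

lemma internalEquiv_lof (x : Fin r) (w : (W x).toSubmodule) :
    internalEquiv hW (DirectSum.lof k _ (fun x => (W x).toSubmodule) x w) = w :=
  DirectSum.coeLinearMap_lof (fun x => (W x).toSubmodule) x w

lemma internalEquiv_symm_coe (x : Fin r) (w : (W x).toSubmodule) :
    (internalEquiv hW).symm w = DirectSum.lof k _ (fun x => (W x).toSubmodule) x w :=
  (LinearEquiv.symm_apply_eq _).2 (internalEquiv_lof hW x w).symm

/-- The projection onto a summand of an internal direct sum decomposition. -/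
noncomputable def internalProj (x : Fin r) :
    σ.IntertwiningMap (W x).toRepresentation where
  toLinearMap := DirectSum.component k _ _ x ∘ₗ (internalEquiv hW).symm.toLinearMap
  isIntertwining' g := by
    have key : ((DirectSum.component k _ _ x ∘ₗ (internalEquiv hW).symm.toLinearMap) ∘ₗ σ g) ∘ₗ
          (internalEquiv hW).toLinearMap =
        ((W x).toRepresentation g ∘ₗ DirectSum.component k _ _ x ∘ₗ
          (internalEquiv hW).symm.toLinearMap) ∘ₗ (internalEquiv hW).toLinearMap := by
      refine DirectSum.linearMap_ext k fun y => LinearMap.ext fun w => ?_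
      simp only [LinearMap.comp_apply, LinearEquiv.coe_coe, internalEquiv_lof]
      rw [show σ g w.1 = ((W y).toRepresentation g w).1 from rfl, internalEquiv_symm_coe,
        internalEquiv_symm_coe]
      by_cases hxy : y = x
      · subst hxy
        simp [DirectSum.component.lof_self]
      · simp [DirectSum.component.of, hxy]
    refine LinearMap.ext fun v => ?_
    simpa using LinearMap.congr_fun key ((internalEquiv hW).symm v)

lemma internalProj_apply (x : Fin r) (v : M) :
    internalProj hW x v = DirectSum.component k _ _ x ((internalEquiv hW).symm v) := rfl

/-- The splitting given by an internal direct sum decomposition. -/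
noncomputable def Splitting.ofIsInternal : Splitting σ (fun x => (W x).toRepresentation) where
  incl x := inclusionMap (W x)
  proj x := internalProj hW x
  proj_incl x w := by
    rw [internalProj_apply, inclusionMap_apply, internalEquiv_symm_coe,
      DirectSum.component.lof_self]
  proj_incl_ne x y w hxy := by
    rw [internalProj_apply, inclusionMap_apply, internalEquiv_symm_coe,
      DirectSum.component.of, dif_neg hxy.symm]
  sum_incl_proj v := by
    obtain ⟨u, rfl⟩ := (internalEquiv hW).surjective v
    simp only [internalProj_apply, LinearEquiv.symm_apply_apply]
    induction u using DirectSum.induction_on with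
    | zero => simp
    | of y w =>
      change ∑ x, inclusionMap (W x) (DirectSum.component k _ _ x
        (DirectSum.lof k _ (fun x => (W x).toSubmodule) y w)) =
          internalEquiv hW (DirectSum.lof k _ (fun x => (W x).toSubmodule) y w)
      rw [internalEquiv_lof, Finset.sum_eq_single y, DirectSum.component.lof_self]
      · rfl
      · intro x _ hxy
        rw [DirectSum.component.of, dif_neg hxy.symm, map_zero]
      · simp
    | add a b ha hb => simp only [map_add, Finset.sum_add_distrib, ha, hb]

end Internal

/-- By additivity each summand contributes 1 or 0 according to whether it is isomorphic to `ρ`. The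
right-hand side does not mention the decomposition, which gives the uniqueness half of Krull–Schmidt
for bricks. -/
lemma IsBrick.occursExactly_eq [FiniteDimensional k S] [FiniteDimensional k M] (h : IsBrick ρ)
    {m : ℕ} (hm : OccursExactly ρ σ m) : m = pairingRank ρ σ := by
  classical
  obtain ⟨r, W, hW, hi, rfl⟩ := hm
  rw [(Splitting.ofIsInternal hW).pairingRank_eq ρ, Set.ncard_eq_toFinset_card',
    Finset.card_eq_sum_ones, Set.toFinset_ofPred, Finset.sum_filter]
  refine Finset.sum_congr rfl fun x _ => ?_
  split_ifs with hx
  · obtain ⟨e⟩ := hx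
    rw [pairingRank_congr ρ e.symm, h.pairingRank_self]
  · rw [h.pairingRank_of_isIndecomposable (hi x) hx]

/-- Induction on a bound for the dimension: a decomposable `A` splits into two nonzero pieces of
smaller dimension, whose decompositions are pushed forward to `σ` and united. -/
lemma exists_supIndep_isIndecomposable (σ : Representation k H M) [FiniteDimensional k M]
    (n : ℕ) (A : Subrepresentation σ) (hn : Module.finrank k A.toSubmodule ≤ n) :
    ∃ s : Finset (Subrepresentation σ), s.SupIndep Subrepresentation.toSubmodule ∧
      s.sup Subrepresentation.toSubmodule = A.toSubmodule ∧
      ∀ B ∈ s, IsIndecomposable B.toRepresentation := by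
  classical
  induction n generalizing A with
  | zero =>
    refine ⟨∅, by simp, ?_, by simp⟩
    rw [Finset.sup_empty, Submodule.finrank_eq_zero.1 (Nat.le_zero.1 hn)]
  | succ n ih =>
    by_cases hA : IsIndecomposable A.toRepresentation
    · exact ⟨{A}, by simp, by simp, by simpa using hA⟩
    by_cases hA0 : A.toSubmodule = ⊥
    · exact ih A (by rw [hA0, finrank_bot]; omega)
    obtain ⟨B, C, hBC, hB, hC⟩ : ∃ B C : Subrepresentation A.toRepresentation,
        IsCompl B C ∧ B ≠ ⊥ ∧ C ≠ ⊥ := by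
      by_contra! h
      exact hA ⟨Submodule.nontrivial_iff_ne_bot.2 hA0, fun B C hBC =>
        or_iff_not_imp_left.2 (h B C hBC)⟩
    have hBC' := isCompl_toSubmodule hBC
    have hfr := Submodule.finrank_add_eq_of_isCompl hBC'
    have hB0 : Module.finrank k B.toSubmodule ≠ 0 := fun h0 =>
      hB (Subrepresentation.toSubmodule_injective (Submodule.finrank_eq_zero.1 h0))
    have hC0 : Module.finrank k C.toSubmodule ≠ 0 := fun h0 =>
      hC (Subrepresentation.toSubmodule_injective (Submodule.finrank_eq_zero.1 h0))
    have hmap : ∀ D : Subrepresentation A.toRepresentation,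
        Module.finrank k ((inclusionMap A).comp (inclusionMap D)).range.toSubmodule =
          Module.finrank k D.toSubmodule := fun D =>
      LinearMap.finrank_range_of_inj (Subtype.val_injective.comp Subtype.val_injective)
    have hrange : ∀ D : Subrepresentation A.toRepresentation,
        ((inclusionMap A).comp (inclusionMap D)).range.toSubmodule =
          D.toSubmodule.map A.toSubmodule.subtype := fun D => by
      change LinearMap.range (A.toSubmodule.subtype ∘ₗ D.toSubmodule.subtype) = _
      rw [LinearMap.range_comp, Submodule.range_subtype]
    obtain ⟨s, hs, hsup, hsi⟩ := ih ((inclusionMap A).comp (inclusionMap B)).range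
      (by rw [hmap]; omega)
    obtain ⟨t, ht, htup, hti⟩ := ih ((inclusionMap A).comp (inclusionMap C)).range
      (by rw [hmap]; omega)
    rw [hrange] at hsup htup
    refine ⟨s ∪ t, hs.union ht ?_, ?_, ?_⟩
    · rw [hsup, htup]
      exact (Submodule.disjoint_map A.toSubmodule.injective_subtype hBC'.disjoint)
    · rw [Finset.sup_union, hsup, htup, ← Submodule.map_sup, hBC'.sup_eq_top,
        Submodule.map_subtype_top]
    · intro D hD
      rcases Finset.mem_union.1 hD with hD | hD
      exacts [hsi D hD, hti D hD]

lemma exists_isInternal_isIndecomposable (σ : Representation k H M) [FiniteDimensional k M] :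
    ∃ (r : ℕ) (W : Fin r → Subrepresentation σ),
      DirectSum.IsInternal (fun x => (W x).toSubmodule) ∧
      (∀ x, IsIndecomposable (W x).toRepresentation) := by
  obtain ⟨s, hs, hsup, hi⟩ := exists_supIndep_isIndecomposable σ _ ⊤ le_rfl
  refine ⟨s.card, fun x => s.equivFin.symm x, ?_, fun x => hi _ (s.equivFin.symm x).2⟩
  rw [DirectSum.isInternal_submodule_iff_iSupIndep_and_iSup_eq_top]
  constructor
  · exact (iSupIndep_comp_coe_iff_supIndep.2 hs).comp s.equivFin.symm.injective
  · rw [s.equivFin.symm.iSup_comp (g := fun B : s => B.1.toSubmodule)]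
    rw [Finset.sup_eq_iSup] at hsup
    rw [iSup_subtype]
    exact hsup

lemma IsBrick.summandMultiplicity_eq [FiniteDimensional k S] [FiniteDimensional k M]
    (h : IsBrick ρ) : summandMultiplicity ρ σ = pairingRank ρ σ := by
  obtain ⟨r, W, hW, hi⟩ := exists_isInternal_isIndecomposable σ
  have hocc : OccursExactly ρ σ _ := ⟨r, W, hW, hi, rfl⟩
  have : {m | OccursExactly ρ σ m} = {pairingRank ρ σ} := by
    ext m
    refine ⟨fun hm => h.occursExactly_eq hm, fun hm => ?_⟩
    rw [Set.mem_singleton_iff.1 hm, ← h.occursExactly_eq hocc]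
    exact hocc
  rw [summandMultiplicity, this, csSup_singleton]

end Multiplicity

end SL2Mod

namespace SL2Mod

open Representation TensorProduct

/-! ### Partial traces on a tensor product -/

section PartialTrace

variable {k : Type*} [Field k] {A B : Type*} [AddCommGroup A] [Module k A] [AddCommGroup B]
  [Module k B] [FiniteDimensional k A] [FiniteDimensional k B]

/-- The partial trace over the second factor. -/
noncomputable def partialTrace : Module.End k (A ⊗[k] B) →ₗ[k] Module.End k A :=
  TensorProduct.lift ((LinearMap.lsmul k (Module.End k A)).flip.compl₂ (LinearMap.trace k B)) ∘ₗ
    (homTensorHomEquiv k A B A B).symm.toLinearMap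

lemma partialTrace_map (f : Module.End k A) (g : Module.End k B) :
    partialTrace (TensorProduct.map f g) = LinearMap.trace k B g • f := by
  have : (homTensorHomEquiv k A B A B).symm (TensorProduct.map f g) = f ⊗ₜ g := by
    rw [LinearEquiv.symm_apply_eq, homTensorHomEquiv_apply, homTensorHomMap_apply]
  simp [partialTrace, this]

lemma end_tensor_induction {P : Module.End k (A ⊗[k] B) → Prop}
    (hmap : ∀ f g, P (TensorProduct.map f g)) (hadd : ∀ x y, P x → P y → P (x + y))
    (x : Module.End k (A ⊗[k] B)) : P x := by
  obtain ⟨y, rfl⟩ := (homTensorHomEquiv k A B A B).surjective x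
  induction y using TensorProduct.induction_on with
  | zero => simpa using hmap 0 0
  | tmul f g =>
    rw [homTensorHomEquiv_apply, homTensorHomMap_apply]
    exact hmap f g
  | add a b ha hb =>
    rw [map_add]
    exact hadd _ _ ha hb

lemma trace_partialTrace (x : Module.End k (A ⊗[k] B)) :
    LinearMap.trace k A (partialTrace x) = LinearMap.trace k (A ⊗[k] B) x := by
  induction x using end_tensor_induction with
  | hmap f g => simp [partialTrace_map, LinearMap.trace_tensorProduct', mul_comm]
  | hadd x y hx hy => simp [hx, hy]

/-- Cyclicity of the trace cancels `b` against `b'`. With group elements for `a, a', b, b'` this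
makes the partial trace of an equivariant endomorphism equivariant. -/
lemma partialTrace_map_comp_comp_map (a a' : Module.End k A) (b b' : Module.End k B)
    (h : b' ∘ₗ b = LinearMap.id) (x : Module.End k (A ⊗[k] B)) :
    partialTrace (TensorProduct.map a b ∘ₗ x ∘ₗ TensorProduct.map a' b') =
      a ∘ₗ partialTrace x ∘ₗ a' := by
  induction x using end_tensor_induction with
  | hmap f g =>
    rw [← TensorProduct.map_comp, ← TensorProduct.map_comp, partialTrace_map, partialTrace_map,
      LinearMap.trace_comp_comm', LinearMap.comp_assoc, h, LinearMap.comp_id,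
      LinearMap.smul_comp, LinearMap.comp_smul]
  | hadd x y hx hy =>
    rw [LinearMap.add_comp, LinearMap.comp_add, map_add, hx, hy, map_add, LinearMap.add_comp,
      LinearMap.comp_add]

end PartialTrace

/-! ### Bricks and splittings in tensor products -/

section Tensor

variable {k H : Type*} [Field k] [Group H]
  {S A B C : Type*} [AddCommGroup S] [Module k S] [AddCommGroup A] [Module k A]
  [AddCommGroup B] [Module k B] [AddCommGroup C] [Module k C]
  {ρ : Representation k H S} {σ : Representation k H A} {τ : Representation k H B}

/-- A brick of nonzero dimension in `k` is never a summand of a tensor product with a brick whose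
dimension vanishes in `k`. -/
lemma IsBrick.pairingRank_tprod_eq_zero [FiniteDimensional k S] [FiniteDimensional k A]
    [FiniteDimensional k B] (hρ : IsBrick ρ) (hS : (Module.finrank k S : k) ≠ 0)
    (hσ : IsBrick σ) (hA : (Module.finrank k A : k) = 0) (τ : Representation k H B) :
    pairingRank ρ (σ.tprod τ) = 0 := by
  by_contra h0
  obtain ⟨α, β, s, hs⟩ := pairingRank_ne_zero.1 h0
  obtain ⟨c, hc⟩ := hρ.2 (β.comp α)
  have hcs : β.toLinearMap ∘ₗ α.toLinearMap = c • LinearMap.id := LinearMap.ext hc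
  -- The trace of `x = α ∘ β` is computed twice. Its partial trace is an endomorphism of the brick
  -- `σ`, hence a scalar `d`, so the trace is `d * dim A = 0`; by cyclicity it is also `c * dim S`.
  -- Since `dim S` is invertible, `c = 0`.
  set x : Module.End k (A ⊗[k] B) := α.toLinearMap ∘ₗ β.toLinearMap with hx
  have hcomm : ∀ g, σ g ∘ₗ partialTrace x ∘ₗ σ g⁻¹ = partialTrace x := fun g => by
    rw [← partialTrace_map_comp_comp_map (σ g) (σ g⁻¹) (τ g) (τ g⁻¹)]
    · congr 1
      have h1 := ((α.comp β).isIntertwining' g)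
      change x ∘ₗ TensorProduct.map (σ g) (τ g) = TensorProduct.map (σ g) (τ g) ∘ₗ x at h1
      rw [← LinearMap.comp_assoc, ← h1, LinearMap.comp_assoc, ← TensorProduct.map_comp,
        ← Module.End.mul_eq_comp (σ g), ← Module.End.mul_eq_comp (τ g), ← map_mul, ← map_mul,
        mul_inv_cancel, map_one, map_one, Module.End.one_eq_id, Module.End.one_eq_id,
        TensorProduct.map_id, LinearMap.comp_id]
    · rw [← Module.End.mul_eq_comp, ← map_mul, inv_mul_cancel, map_one, Module.End.one_eq_id]
  obtain ⟨d, hd⟩ := hσ.2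
    { toLinearMap := partialTrace x
      isIntertwining' := fun g => by
        conv_rhs => rw [← hcomm g⁻¹]
        rw [← LinearMap.comp_assoc, ← Module.End.mul_eq_comp (σ g) (σ g⁻¹), ← map_mul,
          mul_inv_cancel, map_one, Module.End.one_eq_id, LinearMap.id_comp, inv_inv] }
  have hds : partialTrace x = d • LinearMap.id := LinearMap.ext hd
  have h1 : LinearMap.trace k (A ⊗[k] B) x = 0 := by
    rw [← trace_partialTrace, hds, map_smul, LinearMap.trace_id, hA, smul_zero]
  rw [hx, LinearMap.trace_comp_comm', hcs, map_smul, LinearMap.trace_id, smul_eq_mul] at h1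
  refine hs ((hc s).trans ?_)
  rw [(mul_eq_zero.1 h1).resolve_right hS, zero_smul]

/-- Splittings are preserved by tensoring on the right. -/
noncomputable def Splitting.rTensor {ι : Type*} [Fintype ι] {W : ι → Type*}
    [∀ x, AddCommGroup (W x)] [∀ x, Module k (W x)] {θ : ∀ x, Representation k H (W x)}
    (D : Splitting σ θ) (τ : Representation k H B) :
    Splitting (σ.tprod τ) (fun x => (θ x).tprod τ) where
  incl x := (D.incl x).rTensor τ
  proj x := (D.proj x).rTensor τ
  proj_incl x w := by
    induction w using TensorProduct.induction_on with
    | zero => simp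
    | tmul a b => simp [D.proj_incl]
    | add a b ha hb => simp only [map_add, ha, hb]
  proj_incl_ne x y w hxy := by
    induction w using TensorProduct.induction_on with
    | zero => simp
    | tmul a b => simp [D.proj_incl_ne x y _ hxy]
    | add a b ha hb => simp only [map_add, ha, hb, add_zero]
  sum_incl_proj v := by
    induction v using TensorProduct.induction_on with
    | zero => simp
    | tmul a b => simp [← TensorProduct.sum_tmul, D.sum_incl_proj]
    | add a b ha hb => simp only [map_add, Finset.sum_add_distrib, ha, hb]

/-- Exchanging the last two factors of a triple tensor product. -/
noncomputable def tprodRightComm (ρ : Representation k H A) (σ : Representation k H B)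
    (τ : Representation k H C) :
    ((ρ.tprod σ).tprod τ).Equiv ((ρ.tprod τ).tprod σ) :=
  Representation.Equiv.mk (TensorProduct.rightComm k A B C) fun g => by
    ext a b c
    rfl

end Tensor

end SL2Mod

namespace SL2Mod

open Representation MvPolynomial

/-! ### Monomial coordinates on binary forms -/

section Coordinates

variable {k : Type*} [Field k]

/-- The additive group structure on forms, built over the monoid structure that occurs in `V`. -/
noncomputable instance (priority := 2000) homAddCommGroup (m : ℕ) :
    AddCommGroup (homogeneousSubmodule (Fin 2) k m) :=
  { (homogeneousSubmodule (Fin 2) k m).addCommMonoid,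
    (homogeneousSubmodule (Fin 2) k m).addCommGroup with }

/-- The exponent of `X ^ (m - j) * Y ^ j`. -/
noncomputable def expo (m j : ℕ) : Fin 2 →₀ ℕ := Finsupp.single 0 (m - j) + Finsupp.single 1 j

@[simp] lemma expo_zero (m j : ℕ) : expo m j 0 = m - j := by simp [expo]

@[simp] lemma expo_one (m j : ℕ) : expo m j 1 = j := by simp [expo]

lemma degree_fin_two (d : Fin 2 →₀ ℕ) : d.degree = d 0 + d 1 := by
  simp [Finsupp.degree_eq_sum, Fin.sum_univ_two]

lemma degree_expo {m j : ℕ} (h : j ≤ m) : (expo m j).degree = m := by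
  rw [degree_fin_two, expo_zero, expo_one]; omega

lemma expo_degree {m : ℕ} {d : Fin 2 →₀ ℕ} (h : d.degree = m) : expo m (d 1) = d := by
  rw [degree_fin_two] at h
  ext i
  fin_cases i
  · simp; omega
  · simp

lemma expo_injective (m : ℕ) : Function.Injective (expo m) := fun a b h => by
  simpa using DFunLike.congr_fun h 1

/-- The monomial `X ^ (m - j) * Y ^ j` as a homogeneous polynomial of degree `m`. -/
noncomputable def homMonomial {m : ℕ} (j : Fin (m + 1)) : homogeneousSubmodule (Fin 2) k m :=
  ⟨monomial (expo m j) 1, isHomogeneous_monomial 1 (degree_expo (Nat.lt_succ_iff.1 j.2))⟩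

/-- Coordinates of a homogeneous polynomial of degree `m` in two variables. -/
noncomputable def homCoords (m : ℕ) : homogeneousSubmodule (Fin 2) k m ≃ₗ[k] (Fin (m + 1) → k) where
  toFun f j := coeff (expo m j) f.1
  invFun a := ∑ j, a j • homMonomial j
  map_add' f g := by ext; simp
  map_smul' c f := by ext; simp
  left_inv f := by
    classical
    ext d
    simp only [homMonomial, Submodule.coe_sum, Submodule.coe_smul, coeff_sum, coeff_smul,
      coeff_monomial, smul_eq_mul, mul_ite, mul_one, mul_zero]
    by_cases hd : d.degree = m
    · have hd1 : d 1 < m + 1 := by rw [degree_fin_two] at hd; omega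
      rw [Finset.sum_eq_single ⟨d 1, hd1⟩]
      · simp [expo_degree hd]
      · intro j _ hj
        rw [if_neg]
        rintro rfl
        exact hj (Fin.ext (by simp))
      · simp
    · rw [IsHomogeneous.coeff_eq_zero f.2 hd]
      refine Finset.sum_eq_zero fun j _ => if_neg ?_
      rintro rfl
      exact hd (degree_expo (Nat.lt_succ_iff.1 j.2))
  right_inv a := by
    classical
    ext j
    simp [homMonomial, coeff_sum, coeff_monomial, (expo_injective m).eq_iff, Fin.val_inj]

lemma sum_coeff_smul_homMonomial {m : ℕ} (f : homogeneousSubmodule (Fin 2) k m) :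
    ∑ j : Fin (m + 1), coeff (expo m j) f.1 • homMonomial j = f :=
  (homCoords m).symm_apply_apply f

instance (m : ℕ) : FiniteDimensional k (homogeneousSubmodule (Fin 2) k m) :=
  (homCoords m).symm.finiteDimensional

lemma finrank_homogeneousSubmodule (m : ℕ) :
    Module.finrank k (homogeneousSubmodule (Fin 2) k m) = m + 1 := by
  rw [(homCoords m).finrank_eq]; simp

lemma coe_homMonomial {m : ℕ} (j : Fin (m + 1)) :
    (homMonomial j : homogeneousSubmodule (Fin 2) k m).1 = X 0 ^ (m - j : ℕ) * X 1 ^ (j : ℕ) := by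
  change monomial (expo m j) 1 = _
  rw [expo, ← mul_one (1 : k), ← monomial_mul, X_pow_eq_monomial, X_pow_eq_monomial]

end Coordinates

/-! ### The modules `V_n` with `n ≤ p` are bricks -/

section Bricks

variable {p : ℕ} [Fact p.Prime] {k : Type*} [Field k] [CharP k p]

/-- A polynomial of degree less than `p` that vanishes on all `p` elements of the prime field is
zero. -/
lemma eq_zero_of_sum_pow_eq_zero {m : ℕ} (hm : m < p) (a : Fin (m + 1) → k)
    (h : ∀ t : ZMod p, ∑ j, a j * ZMod.castHom (dvd_refl p) k t ^ (j : ℕ) = 0) : a = 0 := by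
  classical
  set e := ZMod.castHom (dvd_refl p) k
  set q : Polynomial k := ∑ j : Fin (m + 1), Polynomial.monomial (j : ℕ) (a j) with hq
  have hdeg : q.natDegree < Fintype.card (ZMod p) := by
    rw [ZMod.card]
    refine lt_of_le_of_lt (Polynomial.natDegree_sum_le_of_forall_le _ _ (n := m) fun j _ => ?_) hm
    exact (Polynomial.natDegree_monomial_le _).trans (Nat.lt_succ_iff.1 j.2)
  have hq0 : q = 0 := by
    refine Polynomial.eq_zero_of_natDegree_lt_card_of_eval_eq_zero q e.injective (fun t => ?_) hdeg
    rw [hq, Polynomial.eval_finsetSum, ← h t]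
    simp [Polynomial.eval_monomial]
  ext j
  have := congrArg (fun r => Polynomial.coeff r (j : ℕ)) hq0
  simpa [hq, Polynomial.finsetSum_coeff, Polynomial.coeff_monomial, Fin.val_inj] using this

/-- The upper unitriangular element with parameter `t`. -/
def upper (t : ZMod p) : G p := ⟨!![1, t; 0, 1], by simp⟩

/-- The lower unitriangular element with parameter `t`. -/
def lower (t : ZMod p) : G p := ⟨!![1, 0; t, 1], by simp⟩

variable (k) in
lemma subst_upper (t : ZMod p) : subst p k (upper t) =
    aeval ![X 0, C (ZMod.castHom (dvd_refl p) k t) * X 0 + X 1] := by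
  simp [subst, upper]

variable (k) in
lemma subst_lower (t : ZMod p) : subst p k (lower t) =
    aeval ![X 0 + C (ZMod.castHom (dvd_refl p) k t) * X 1, X 1] := by
  simp [subst, lower]

/-- Invariants of the upper unitriangular subgroup in low degree. -/
lemma eq_smul_of_upper_invariant {m : ℕ} (hm : m < p) (f : homogeneousSubmodule (Fin 2) k m)
    (hf : ∀ t : ZMod p, subst p k (upper t) f.1 = f.1) :
    f = coeff (expo m 0) f.1 • homMonomial 0 := by
  classical
  -- Dehomogenising at `X = 1` turns invariance under `upper t` into `f(1, t) = f(1, 0)`: a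
  -- polynomial in `t` of degree less than `p` that is constant on the prime field.
  have heval : ∀ t : ZMod p, MvPolynomial.eval ![1, ZMod.castHom (dvd_refl p) k t] f.1 =
      MvPolynomial.eval ![1, 0] f.1 := fun t => by
    conv_rhs => rw [← hf t, subst_upper]
    rw [← MvPolynomial.coe_aeval_eq_eval, ← MvPolynomial.coe_aeval_eq_eval]
    simp only [RingHom.coe_coe]
    rw [← AlgHom.comp_apply]
    congr 1
    apply MvPolynomial.algHom_ext
    intro i
    fin_cases i <;> simp
  have hsum : ∀ t : k, MvPolynomial.eval ![1, t] f.1 =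
      ∑ j : Fin (m + 1), coeff (expo m j) f.1 * t ^ (j : ℕ) := fun t => by
    conv_lhs => rw [← sum_coeff_smul_homMonomial f]
    simp [coe_homMonomial, smul_eval]
  have h0 := eq_zero_of_sum_pow_eq_zero (p := p) hm
    (fun j : Fin (m + 1) => if j = 0 then 0 else coeff (expo m j) f.1) (fun t => by
      have := heval t
      rw [hsum, hsum, Fin.sum_univ_succ, Fin.sum_univ_succ] at this
      rw [Fin.sum_univ_succ]
      simpa [Fin.succ_ne_zero] using this)
  conv_lhs => rw [← sum_coeff_smul_homMonomial f]
  rw [Finset.sum_eq_single 0]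
  · simp
  · intro j _ hj
    have := congrFun h0 j
    rw [if_neg hj] at this
    rw [this, Pi.zero_apply, zero_smul]
  · simp

/-- The translates `(X + tY)^m` of `X^m` span all forms: their coefficients `m.choose j * t^j`
involve binomials that are invertible because `m < p`, and the powers of `t` separate the monomials.
-/
lemma eq_zero_of_lower_translates {M : Type*} [AddCommGroup M] [Module k M] {m : ℕ} (hm : m < p)
    (φ : homogeneousSubmodule (Fin 2) k m →ₗ[k] M)
    (h : ∀ t : ZMod p, φ ⟨subst p k (lower t) (homMonomial 0 : homogeneousSubmodule (Fin 2) k m).1,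
      subst_mem p k (lower t) m _ (homMonomial 0).2⟩ = 0) : φ = 0 := by
  have hexp : ∀ t : ZMod p, (⟨subst p k (lower t) (homMonomial 0 :
      homogeneousSubmodule (Fin 2) k m).1, subst_mem p k (lower t) m _ (homMonomial 0).2⟩ :
        homogeneousSubmodule (Fin 2) k m) = ∑ j : Fin (m + 1),
          ((m.choose j : k) * ZMod.castHom (dvd_refl p) k t ^ (j : ℕ)) • homMonomial j := fun t => by
    refine Subtype.ext ?_
    simp only [coe_homMonomial, Submodule.coe_sum, Submodule.coe_smul, subst_lower]
    simp only [Fin.val_zero, Nat.sub_zero, pow_zero, mul_one, map_pow, aeval_X,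
      Matrix.cons_val_zero]
    rw [add_comm, add_pow, Finset.sum_range]
    refine Finset.sum_congr rfl fun j _ => ?_
    rw [smul_eq_C_mul, map_mul, map_pow, map_natCast, mul_pow]
    ring
  have hmon : ∀ j : Fin (m + 1), φ (homMonomial j) = 0 := fun j => by
    -- Linear functionals reduce the claim to scalar coefficients, where the root count applies.
    rw [← Module.forall_dual_apply_eq_zero_iff k]
    intro l
    have h0 := congrFun (eq_zero_of_sum_pow_eq_zero (p := p) hm
      (fun j : Fin (m + 1) => (m.choose j : k) * l (φ (homMonomial j))) (fun t => by
        have := congrArg l (h t)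
        rw [hexp, map_sum, map_sum, map_zero] at this
        rw [← this]
        refine Finset.sum_congr rfl fun j _ => ?_
        rw [map_smul, map_smul, smul_eq_mul]
        ring)) j
    refine (mul_eq_zero.1 h0).resolve_left ?_
    intro hcast
    have hdvd := (CharP.cast_eq_zero_iff k p _).1 hcast
    have hdvd' : p ∣ m.factorial := by
      rw [← Nat.choose_mul_factorial_mul_factorial (Nat.lt_succ_iff.1 j.2)]
      exact (hdvd.mul_right _).mul_right _
    exact absurd (((Fact.out : p.Prime).dvd_factorial).1 hdvd') (not_le.2 hm)
  ext1 f
  rw [← sum_coeff_smul_homMonomial f]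
  simp [hmon]

variable (p k) in
-- A highest weight argument: the line spanned by the top power of `X` is the space of invariants of
-- the upper unitriangular group, so `φ` acts on it by a scalar `c`. Then `φ - c` kills every lower
-- translate of that power, and these span.
lemma isBrick_V {n : ℕ} (h1 : 1 ≤ n) (hn : n ≤ p) : IsBrick (V p k n) := by
  obtain ⟨m, rfl⟩ : ∃ m, n = m + 1 := ⟨n - 1, by omega⟩
  constructor
  · refine Module.nontrivial_of_finrank_pos (R := k) ?_
    rw [finrank_homogeneousSubmodule]
    omega
  · intro φ
    have hm : m + 1 - 1 < p := by omega
    set c := coeff (expo (m + 1 - 1) 0) (φ (homMonomial 0)).1 with hc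
    refine ⟨c, ?_⟩
    have hfix : φ (homMonomial 0) = c • homMonomial 0 := by
      refine eq_smul_of_upper_invariant (p := p) hm _ fun t => ?_
      have h1 := φ.isIntertwining _ _ (upper t) (homMonomial 0)
      have h2 : V p k (m + 1) (upper t) (homMonomial 0) = homMonomial 0 := by
        refine Subtype.ext ?_
        change subst p k (upper t) (homMonomial 0 : homogeneousSubmodule (Fin 2) k (m + 1 - 1)).1 = _
        rw [coe_homMonomial, subst_upper]
        simp
      rw [h2] at h1
      exact (congrArg Subtype.val h1).symm
    have hz : φ.toLinearMap - c • LinearMap.id = 0 := by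
      refine eq_zero_of_lower_translates (p := p) hm _ fun t => ?_
      have h1 := φ.isIntertwining _ _ (lower t) (homMonomial 0)
      rw [hfix, map_smul] at h1
      exact sub_eq_zero.2 h1
    intro s
    exact sub_eq_zero.1 (LinearMap.congr_fun hz s)

end Bricks

end SL2Mod

namespace SL2Mod

open Representation MvPolynomial TensorProduct

/-! ### Products and partial derivatives of binary forms -/

section Operators

variable {k : Type*} [Field k]

/-- Multiplication of homogeneous polynomials. -/
noncomputable def homMul {a b c : ℕ} (h : a + b = c) :
    homogeneousSubmodule (Fin 2) k a →ₗ[k] homogeneousSubmodule (Fin 2) k b →ₗ[k]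
      homogeneousSubmodule (Fin 2) k c :=
  LinearMap.mk₂ k (fun f g => ⟨f.1 * g.1, h ▸ IsHomogeneous.mul f.2 g.2⟩)
    (fun _ _ _ => Subtype.ext (add_mul _ _ _)) (fun _ _ _ => Subtype.ext (smul_mul_assoc _ _ _))
    (fun _ _ _ => Subtype.ext (mul_add _ _ _)) (fun _ _ _ => Subtype.ext (mul_smul_comm _ _ _))

@[simp] lemma coe_homMul {a b c : ℕ} (h : a + b = c) (f : homogeneousSubmodule (Fin 2) k a)
    (g : homogeneousSubmodule (Fin 2) k b) : (homMul h f g).1 = f.1 * g.1 := rfl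

/-- Partial derivatives of homogeneous polynomials. -/
noncomputable def homPDeriv {a b : ℕ} (h : a - 1 = b) (i : Fin 2) :
    homogeneousSubmodule (Fin 2) k a →ₗ[k] homogeneousSubmodule (Fin 2) k b :=
  (pderiv i).toLinearMap.restrict fun _ hf => h ▸ IsHomogeneous.pderiv hf

@[simp] lemma coe_homPDeriv {a b : ℕ} (h : a - 1 = b) (i : Fin 2)
    (f : homogeneousSubmodule (Fin 2) k a) : (homPDeriv h i f).1 = pderiv i f.1 := rfl

/-- The variables as linear forms. -/
noncomputable def homX (i : Fin 2) : homogeneousSubmodule (Fin 2) k (2 - 1) :=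
  ⟨X i, isHomogeneous_X k i⟩

@[simp] lemma coe_homX (i : Fin 2) : (homX i : homogeneousSubmodule (Fin 2) k (2 - 1)).1 = X i := rfl

lemma exists_eq_smul_homX (f : homogeneousSubmodule (Fin 2) k (2 - 1)) :
    ∃ a b : k, f = a • homX 0 + b • homX 1 := by
  refine ⟨_, _, ((sum_coeff_smul_homMonomial f).symm.trans (Fin.sum_univ_two _)).trans
    (congrArg₂ _ (congrArg _ (Subtype.ext ?_)) (congrArg _ (Subtype.ext ?_)))⟩
  · simp [coe_homMonomial]
  · simp [coe_homMonomial]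

lemma pderiv_pderiv_comm (f : MvPolynomial (Fin 2) k) (i j : Fin 2) :
    pderiv i (pderiv j f) = pderiv j (pderiv i f) := by
  induction f using MvPolynomial.induction_on with
  | C a => simp
  | add f h hf hh => simp only [map_add, hf, hh]
  | mul_X f l hf =>
    fin_cases i <;> fin_cases j <;> fin_cases l <;>
      simp_all [Derivation.leibniz, pderiv_X] <;> ring

end Operators

/-! ### Behaviour of products and derivatives under the group -/

section Equivariance

variable {p : ℕ} {k : Type*} [Field k] [CharP k p]

lemma coe_V (n : ℕ) (g : G p) (f : homogeneousSubmodule (Fin 2) k (n - 1)) :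
    (V p k n g f).1 = subst p k g f.1 := rfl

variable (k) in
/-- The entries of `g`, read in `k`. -/
def entry (g : G p) (i j : Fin 2) : k := ZMod.castHom (dvd_refl p) k (g i j)

lemma entry_det (g : G p) : entry k g 0 0 * entry k g 1 1 - entry k g 0 1 * entry k g 1 0 = 1 := by
  have := Matrix.det_fin_two g.1
  rw [g.2] at this
  simp only [entry, ← map_mul, ← map_sub]
  rw [← map_one (ZMod.castHom (dvd_refl p) k)]
  exact congrArg _ this.symm

lemma subst_X (g : G p) (i : Fin 2) :
    subst p k g (X i) = C (entry k g 0 i) * X 0 + C (entry k g 1 i) * X 1 := by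
  fin_cases i <;> simp [subst, entry]

/-- The chain rule for a linear substitution, checked on generators. -/
lemma pderiv_subst (g : G p) (i : Fin 2) (f : MvPolynomial (Fin 2) k) :
    pderiv i (subst p k g f) = C (entry k g i 0) * subst p k g (pderiv 0 f) +
      C (entry k g i 1) * subst p k g (pderiv 1 f) := by
  induction f using MvPolynomial.induction_on with
  | C a => simp [subst]
  | add f h hf hh => simp only [map_add, hf, hh]; ring
  | mul_X f j hf =>
    simp only [map_mul, Derivation.leibniz, hf, map_add, smul_eq_mul, subst_X, pderiv_C]
    fin_cases i <;> fin_cases j <;> simp [pderiv_X] <;> ring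

lemma V_homMul {a b c : ℕ} (h : (a - 1) + (b - 1) = c - 1) (g : G p)
    (x : homogeneousSubmodule (Fin 2) k (a - 1)) (y : homogeneousSubmodule (Fin 2) k (b - 1)) :
    V p k c g (homMul h x y) = homMul h (V p k a g x) (V p k b g y) :=
  Subtype.ext (map_mul (subst p k g) x.1 y.1)

lemma V_homX (g : G p) (i : Fin 2) :
    V p k 2 g (homX i) = entry k g 0 i • homX 0 + entry k g 1 i • homX 1 := by
  refine Subtype.ext ((subst_X g i).trans ?_)
  simp [smul_eq_C_mul]

lemma homPDeriv_V {a b : ℕ} (h : a - 1 - 1 = b - 1) (g : G p) (i : Fin 2)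
    (f : homogeneousSubmodule (Fin 2) k (a - 1)) :
    homPDeriv h i (V p k a g f) = entry k g i 0 • V p k b g (homPDeriv h 0 f) +
      entry k g i 1 • V p k b g (homPDeriv h 1 f) := by
  refine Subtype.ext ((pderiv_subst g i f.1).trans ?_)
  simp [smul_eq_C_mul, coe_V]

end Equivariance

section FinTwo

variable {k H M : Type*} [Field k] [Monoid H] [AddCommGroup M] [Module k M]
  {σ : Representation k H M} {W : Fin 2 → Type*} [∀ x, AddCommGroup (W x)] [∀ x, Module k (W x)]
  {θ : ∀ x, Representation k H (W x)}

/-- A splitting into two summands. -/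
def Splitting.ofFinTwo (i₀ : (θ 0).IntertwiningMap σ) (i₁ : (θ 1).IntertwiningMap σ)
    (p₀ : σ.IntertwiningMap (θ 0)) (p₁ : σ.IntertwiningMap (θ 1))
    (h₀₀ : ∀ w, p₀ (i₀ w) = w) (h₀₁ : ∀ w, p₀ (i₁ w) = 0)
    (h₁₀ : ∀ w, p₁ (i₀ w) = 0) (h₁₁ : ∀ w, p₁ (i₁ w) = w)
    (h : ∀ v, i₀ (p₀ v) + i₁ (p₁ v) = v) : Splitting σ θ where
  incl := Fin.cons i₀ (Fin.cons i₁ finZeroElim)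
  proj := Fin.cons p₀ (Fin.cons p₁ finZeroElim)
  proj_incl := Fin.forall_fin_two.2 ⟨h₀₀, h₁₁⟩
  proj_incl_ne := Fin.forall_fin_two.2 ⟨Fin.forall_fin_two.2 ⟨fun _ h => absurd rfl h,
    fun w _ => h₀₁ w⟩, Fin.forall_fin_two.2 ⟨fun w _ => h₁₀ w, fun _ h => absurd rfl h⟩⟩
  sum_incl_proj v := (Fin.sum_univ_two _).trans (h v)

end FinTwo

/-! ### The decomposition of `V_2 ⊗ V_n` -/

section ClebschGordan

variable (p : ℕ) (k : Type*) [Field k] [CharP k p]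

/-- Multiplication of polynomials as a map `V_a ⊗ V_b → V_(a+b-1)`. -/
noncomputable def mulMap {a b c : ℕ} (h : (a - 1) + (b - 1) = c - 1) :
    ((V p k a).tprod (V p k b)).IntertwiningMap (V p k c) where
  toLinearMap := TensorProduct.lift (homMul h)
  isIntertwining' g := TensorProduct.ext' fun x y => (V_homMul h g x y).symm

lemma mulMap_tmul {a b c : ℕ} (h : (a - 1) + (b - 1) = c - 1) (x y) :
    mulMap p k h (x ⊗ₜ y) = homMul h x y := rfl

/-- The gradient `f ↦ X ⊗ ∂f/∂X + Y ⊗ ∂f/∂Y`. -/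
noncomputable def gradMap {a b : ℕ} (h : a - 1 - 1 = b - 1) :
    (V p k a).IntertwiningMap ((V p k 2).tprod (V p k b)) where
  toLinearMap := TensorProduct.mk k (homogeneousSubmodule (Fin 2) k (2 - 1)) _ (homX 0) ∘ₗ
      homPDeriv h 0 +
    TensorProduct.mk k (homogeneousSubmodule (Fin 2) k (2 - 1)) _ (homX 1) ∘ₗ homPDeriv h 1
  isIntertwining' g := by
    refine LinearMap.ext fun f => ?_
    simp only [LinearMap.comp_apply, LinearMap.add_apply, TensorProduct.mk_apply, map_add,
      Representation.tprod_apply, TensorProduct.map_tmul, V_homX, homPDeriv_V h, add_tmul, ← smul_tmul',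
      tmul_smul]
    module

lemma gradMap_apply {a b : ℕ} (h : a - 1 - 1 = b - 1) (f) :
    gradMap p k h f = homX 0 ⊗ₜ homPDeriv h 0 f + homX 1 ⊗ₜ homPDeriv h 1 f := rfl

/-- The map `f ↦ X ⊗ Y f - Y ⊗ X f`. -/
noncomputable def wedgeMap {a b : ℕ} (h : (2 - 1) + (a - 1) = b - 1) :
    (V p k a).IntertwiningMap ((V p k 2).tprod (V p k b)) where
  toLinearMap := TensorProduct.mk k (homogeneousSubmodule (Fin 2) k (2 - 1)) _ (homX 0) ∘ₗ
      homMul h (homX 1) -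
    TensorProduct.mk k (homogeneousSubmodule (Fin 2) k (2 - 1)) _ (homX 1) ∘ₗ homMul h (homX 0)
  isIntertwining' g := by
    refine LinearMap.ext fun f => ?_
    simp only [LinearMap.comp_apply, LinearMap.sub_apply, TensorProduct.mk_apply, map_sub,
      Representation.tprod_apply, TensorProduct.map_tmul, V_homMul h, V_homX, map_add, map_smul,
      LinearMap.add_apply, LinearMap.smul_apply, tmul_add, add_tmul, ← smul_tmul', tmul_smul]
    -- The tensor `X ⊗ Y - Y ⊗ X` is multiplied by `det g`, which is 1.
    have hdet := entry_det (k := k) g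
    match_scalars <;> first | linear_combination -hdet | linear_combination hdet | ring

lemma wedgeMap_apply {a b : ℕ} (h : (2 - 1) + (a - 1) = b - 1) (f) :
    wedgeMap p k h f = homX 0 ⊗ₜ homMul h (homX 1) f - homX 1 ⊗ₜ homMul h (homX 0) f := rfl

/-- The Jacobian `l ⊗ f ↦ ∂l/∂X ∂f/∂Y - ∂l/∂Y ∂f/∂X`. -/
noncomputable def jacobianMap {a b c d : ℕ} (ha : a - 1 - 1 = c - 1) (hb : b - 1 - 1 = d - 1)
    {e : ℕ} (h : (c - 1) + (d - 1) = e - 1) :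
    ((V p k a).tprod (V p k b)).IntertwiningMap (V p k e) where
  toLinearMap := TensorProduct.lift ((homMul h).compl₁₂ (homPDeriv ha 0) (homPDeriv hb 1) -
    (homMul h).compl₁₂ (homPDeriv ha 1) (homPDeriv hb 0))
  isIntertwining' g := TensorProduct.ext' fun x y => by
    have hdet : (C (entry k g 0 0) * C (entry k g 1 1) - C (entry k g 0 1) * C (entry k g 1 0) :
        MvPolynomial (Fin 2) k) = 1 := by
      rw [← C_mul, ← C_mul, ← C_sub, entry_det, C_1]
    refine Subtype.ext ?_
    simp only [LinearMap.comp_apply, Representation.tprod_apply, TensorProduct.map_tmul, TensorProduct.lift.tmul,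
      LinearMap.sub_apply, LinearMap.compl₁₂_apply, Submodule.coe_sub, coe_homMul, coe_homPDeriv,
      coe_V, pderiv_subst, map_sub, map_mul]
    linear_combination (subst p k g (pderiv 0 x.1) * subst p k g (pderiv 1 y.1) -
      subst p k g (pderiv 1 x.1) * subst p k g (pderiv 0 y.1)) * hdet

lemma coe_jacobianMap_tmul {a b c d e : ℕ} (ha : a - 1 - 1 = c - 1) (hb : b - 1 - 1 = d - 1)
    (h : (c - 1) + (d - 1) = e - 1) (x y) :
    (jacobianMap p k ha hb h (x ⊗ₜ y)).1 =
      pderiv 0 x.1 * pderiv 1 y.1 - pderiv 1 x.1 * pderiv 0 y.1 := rfl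

lemma euler {n : ℕ} (f : homogeneousSubmodule (Fin 2) k n) :
    X 0 * pderiv 0 f.1 + X 1 * pderiv 1 f.1 = (n : MvPolynomial (Fin 2) k) * f.1 := by
  have := IsHomogeneous.sum_X_mul_pderiv f.2
  rwa [Fin.sum_univ_two, nsmul_eq_mul] at this

section Relations

variable {n : ℕ} (h1 : (2 - 1) + (n - 1) = n + 1 - 1) (h2 : n + 1 - 1 - 1 = n - 1)
  (h3 : (2 - 1) + (n - 1 - 1) = n - 1) (h4 : 2 - 1 - 1 = 1 - 1) (h5 : n - 1 - 1 = n - 1 - 1)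
  (h6 : (1 - 1) + (n - 1 - 1) = n - 1 - 1)

lemma cast_sub_one_add_one (hn : 1 ≤ n) :
    ((n - 1 : ℕ) : MvPolynomial (Fin 2) k) + 1 = (n : MvPolynomial (Fin 2) k) := by
  rw [← Nat.cast_add_one, Nat.sub_add_cancel hn]

/-- Euler's identity for a form of degree `n`. -/
lemma mulMap_gradMap (f) : mulMap p k h1 (gradMap p k h2 f) = (n : k) • f := by
  refine Subtype.ext ?_
  rw [gradMap_apply, map_add, mulMap_tmul, mulMap_tmul]
  have := euler k f
  simp only [Nat.add_sub_cancel] at this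
  simpa [smul_eq_C_mul] using this

lemma mulMap_wedgeMap (f) : mulMap p k h1 (wedgeMap p k h3 f) = 0 := by
  refine Subtype.ext ?_
  rw [wedgeMap_apply, map_sub, mulMap_tmul, mulMap_tmul]
  simp only [Submodule.coe_sub, coe_homMul, coe_homX, ZeroMemClass.coe_zero]
  ring

/-- This is the equality of mixed partial derivatives. -/
lemma jacobianMap_gradMap (f) : jacobianMap p k h4 h5 h6 (gradMap p k h2 f) = 0 := by
  refine Subtype.ext ?_
  rw [gradMap_apply, map_add, Submodule.coe_add, coe_jacobianMap_tmul, coe_jacobianMap_tmul]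
  simp only [coe_homX, coe_homPDeriv, pderiv_X_self, pderiv_X_of_ne (zero_ne_one (α := Fin 2)),
    pderiv_X_of_ne (one_ne_zero (α := Fin 2)), ZeroMemClass.coe_zero]
  rw [pderiv_pderiv_comm f.1 1 0]
  ring

/-- Here `n = (n - 2) + 2`: Euler's identity in degree `n - 2` gives the first term, and
differentiating the factors `X` and `Y` gives the 2. The bound `2 ≤ n` makes the truncated degree `n
- 1 - 1` correct. -/
lemma jacobianMap_wedgeMap (hn : 2 ≤ n) (f) :
    jacobianMap p k h4 h5 h6 (wedgeMap p k h3 f) = (n : k) • f := by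
  refine Subtype.ext ?_
  have he := euler k f
  have hc : ((n - 1 - 1 : ℕ) : MvPolynomial (Fin 2) k) + 2 = C (n : k) := by
    rw [map_natCast]
    norm_cast
    congr 1
    omega
  rw [wedgeMap_apply, map_sub, Submodule.coe_sub, coe_jacobianMap_tmul, coe_jacobianMap_tmul]
  simp only [coe_homX, coe_homMul, Derivation.leibniz, pderiv_X_self, smul_eq_mul,
    pderiv_X_of_ne (zero_ne_one (α := Fin 2)), pderiv_X_of_ne (one_ne_zero (α := Fin 2)),
    Submodule.coe_smul, smul_eq_C_mul]
  linear_combination he + f.1 * hc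

/-- By linearity it suffices to treat `X ⊗ f` and `Y ⊗ f` and to compare the components along `X`
and `Y`. Here `n = (n - 1) + 1`, from Euler's identity in degree `n - 1` and one Leibniz term. -/
lemma gradMap_mulMap_add (hn : 1 ≤ n) (v) : gradMap p k h2 (mulMap p k h1 v) +
    wedgeMap p k h3 (jacobianMap p k h4 h5 h6 v) = (n : k) • v := by
  induction v using TensorProduct.induction_on with
  | zero => simp
  | add a b ha hb => rw [smul_add, ← ha, ← hb]; simp only [map_add]; abel
  | tmul l f =>
    obtain ⟨a, b, rfl⟩ := exists_eq_smul_homX l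
    have he := euler k f
    have hc := cast_sub_one_add_one k hn
    have hX : gradMap p k h2 (mulMap p k h1 (homX 0 ⊗ₜ f)) +
        wedgeMap p k h3 (jacobianMap p k h4 h5 h6 (homX 0 ⊗ₜ f)) = (n : k) • (homX 0 ⊗ₜ f) := by
      have e1 : homPDeriv h2 0 (homMul h1 (homX 0) f) +
          homMul h3 (homX 1) (jacobianMap p k h4 h5 h6 (homX 0 ⊗ₜ f)) = (n : k) • f := by
        refine Subtype.ext ?_
        simp only [Submodule.coe_add, coe_homPDeriv, coe_homMul, coe_homX, coe_jacobianMap_tmul,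
          Derivation.leibniz, pderiv_X_self, pderiv_X_of_ne (zero_ne_one (α := Fin 2)), smul_eq_mul,
          Submodule.coe_smul, smul_eq_C_mul, map_natCast]
        linear_combination he + f.1 * hc
      have e2 : homPDeriv h2 1 (homMul h1 (homX 0) f) =
          homMul h3 (homX 0) (jacobianMap p k h4 h5 h6 (homX 0 ⊗ₜ f)) := by
        refine Subtype.ext ?_
        simp only [coe_homPDeriv, coe_homMul, coe_homX, coe_jacobianMap_tmul,
          Derivation.leibniz, pderiv_X_self, pderiv_X_of_ne (zero_ne_one (α := Fin 2)), smul_eq_mul]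
        ring
      rw [mulMap_tmul, gradMap_apply, wedgeMap_apply, e2, ← tmul_smul, ← e1, tmul_add]
      abel
    have hY : gradMap p k h2 (mulMap p k h1 (homX 1 ⊗ₜ f)) +
        wedgeMap p k h3 (jacobianMap p k h4 h5 h6 (homX 1 ⊗ₜ f)) = (n : k) • (homX 1 ⊗ₜ f) := by
      have e1 : homPDeriv h2 1 (homMul h1 (homX 1) f) -
          homMul h3 (homX 0) (jacobianMap p k h4 h5 h6 (homX 1 ⊗ₜ f)) = (n : k) • f := by
        refine Subtype.ext ?_
        simp only [Submodule.coe_sub, coe_homPDeriv, coe_homMul, coe_homX, coe_jacobianMap_tmul,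
          Derivation.leibniz, pderiv_X_self, pderiv_X_of_ne (one_ne_zero (α := Fin 2)), smul_eq_mul,
          Submodule.coe_smul, smul_eq_C_mul, map_natCast]
        linear_combination he + f.1 * hc
      have e2 : homPDeriv h2 0 (homMul h1 (homX 1) f) =
          -homMul h3 (homX 1) (jacobianMap p k h4 h5 h6 (homX 1 ⊗ₜ f)) := by
        refine Subtype.ext ?_
        simp only [Submodule.coe_neg, coe_homPDeriv, coe_homMul, coe_homX, coe_jacobianMap_tmul,
          Derivation.leibniz, pderiv_X_self, pderiv_X_of_ne (one_ne_zero (α := Fin 2)), smul_eq_mul]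
        ring
      rw [mulMap_tmul, gradMap_apply, wedgeMap_apply, e2, ← tmul_smul, ← e1, tmul_sub, tmul_neg]
      abel
    rw [add_tmul, ← smul_tmul', ← smul_tmul', smul_add, smul_comm _ a, smul_comm _ b, ← hX, ← hY]
    simp only [map_add, map_smul]
    module

end Relations

/-- The splitting `V_2 ⊗ V_n = V_(n+1) ⊕ V_(n-1)` for `n` invertible in `k`. -/
noncomputable def splittingTwo {n : ℕ} (hn : 2 ≤ n) (hk : (n : k) ≠ 0) :
    Splitting ((V p k 2).tprod (V p k n)) (fun x : Fin 2 => V p k (![n + 1, n - 1] x)) :=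
  have h1 : (2 - 1) + (n - 1) = n + 1 - 1 := by omega
  have h2 : n + 1 - 1 - 1 = n - 1 := rfl
  have h3 : (2 - 1) + (n - 1 - 1) = n - 1 := by omega
  have h6 : (1 - 1) + (n - 1 - 1) = n - 1 - 1 := by omega
  .ofFinTwo (gradMap p k h2) (wedgeMap p k h3) ((n : k)⁻¹ • mulMap p k h1)
    ((n : k)⁻¹ • jacobianMap p k rfl rfl h6)
    (fun w => (congrArg ((n : k)⁻¹ • ·) (mulMap_gradMap p k h1 h2 w)).trans
      (inv_smul_smul₀ hk w))
    (fun w => (congrArg ((n : k)⁻¹ • ·) (mulMap_wedgeMap p k h1 h3 w)).trans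
      (smul_zero (n : k)⁻¹))
    (fun w => (congrArg ((n : k)⁻¹ • ·) (jacobianMap_gradMap p k h2 rfl rfl h6 w)).trans
      (smul_zero (n : k)⁻¹))
    (fun w => (congrArg ((n : k)⁻¹ • ·) (jacobianMap_wedgeMap p k h3 rfl rfl h6 hn w)).trans
      (inv_smul_smul₀ hk w))
    (fun v => by
      have key : gradMap p k h2 (((n : k)⁻¹ • mulMap p k h1) v) +
          wedgeMap p k h3 (((n : k)⁻¹ • jacobianMap p k rfl rfl h6) v) = v := by
        rw [IntertwiningMap.smul_apply, IntertwiningMap.smul_apply, map_smul, map_smul, ← smul_add,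
          gradMap_mulMap_add p k h1 h2 h3 rfl rfl h6 (by omega), inv_smul_smul₀ hk]
      exact key)

/-- The isomorphism `V_1 ⊗ V_n = V_n`, as a splitting with one summand. -/
noncomputable def splittingOne (n : ℕ) :
    Splitting ((V p k 1).tprod (V p k n)) (fun _ : Unit => V p k n) where
  incl _ :=
    { toLinearMap := TensorProduct.mk k (homogeneousSubmodule (Fin 2) k (1 - 1)) _
        ⟨1, isHomogeneous_one _ _⟩
      isIntertwining' g := by
        refine LinearMap.ext fun f => congrArg (· ⊗ₜ _) (Subtype.ext ?_)
        exact (map_one (subst p k g)).symm }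
  proj _ := mulMap p k (by omega)
  proj_incl _ w := Subtype.ext (one_mul _)
  proj_incl_ne x y w hxy := absurd rfl hxy
  sum_incl_proj v := by
    rw [Finset.univ_unique, Finset.sum_singleton]
    induction v using TensorProduct.induction_on with
    | zero => simp
    | add a b ha hb => rw [map_add, map_add, ha, hb]
    | tmul a b =>
      obtain ⟨c, rfl⟩ : ∃ c : k, a = c • ⟨1, isHomogeneous_one _ _⟩ := by
        refine ⟨_, (sum_coeff_smul_homMonomial a).symm.trans ((Fin.sum_univ_one _).trans
          (congrArg _ (Subtype.ext ?_)))⟩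
        simp [coe_homMonomial]
      rw [← smul_tmul', map_smul, map_smul]
      refine congrArg (c • ·) (congrArg (_ ⊗ₜ ·) (Subtype.ext ?_))
      exact one_mul b.1

end ClebschGordan

end SL2Mod

namespace SL2Mod

open Representation TensorProduct

/-! ### The combinatorial recursion for the fusion rule -/

section Fusion

/-- The fusion rule for `V_i ⊗ V_j` and `V_l`. -/
def FusionRule (p i j l : ℕ) : Prop :=
  i + j + l ≡ 1 [MOD 2] ∧ i + j + l < 2 * p ∧ l < i + j ∧ i < j + l ∧ j < l + i

instance (p i j l : ℕ) : Decidable (FusionRule p i j l) := by unfold FusionRule; infer_instance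

/-- The boundary needs no separate case: the rule fails when an index is 0, since the strict
triangle inequalities clash, and when `j + 1 = p`, since `p < l + i` contradicts `i + p + l < 2 *
p`. -/
lemma fusionRule_recursion {p i j l : ℕ} (hi : 1 ≤ i) (hip : i + 1 < p) (hj : 1 ≤ j) (hjp : j < p)
    (hl : 1 ≤ l) (hlp : l < p) :
    (if FusionRule p (i + 1) j l then 1 else 0) + (if FusionRule p (i - 1) j l then 1 else 0) =
      (if FusionRule p i (j + 1) l then 1 else 0) +
        (if FusionRule p i (j - 1) l then 1 else 0) := by
  by_cases h1 : FusionRule p (i + 1) j l <;> by_cases h2 : FusionRule p (i - 1) j l <;>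
    by_cases h3 : FusionRule p i (j + 1) l <;> by_cases h4 : FusionRule p i (j - 1) l <;>
    simp only [h1, h2, h3, h4, if_true, if_false] <;>
    (unfold FusionRule Nat.ModEq at *; omega)

/-- The Clebsch–Gordan recursion and its boundary values determine the fusion rule. -/
lemma eq_fusionRule_of_recursion {p l : ℕ} (hl : 1 ≤ l) (hlp : l < p) (N : ℕ → ℕ → ℕ)
    (h0 : ∀ j, N 0 j = 0) (h0' : ∀ i, N i 0 = 0) (hp : ∀ i, N i p = 0)
    (h1 : ∀ j, 1 ≤ j → j < p → N 1 j = if j = l then 1 else 0)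
    (hrec : ∀ i j, 1 ≤ i → i < p → 1 ≤ j → j < p →
      N (i + 1) j + N (i - 1) j = N i (j + 1) + N i (j - 1))
    {i j : ℕ} (hi : i < p) (hj : j ≤ p) :
    N i j = if FusionRule p i j l then 1 else 0 := by
  induction i using Nat.strong_induction_on generalizing j with
  | _ i ih =>
    have hb0 : ¬ FusionRule p i 0 l := by unfold FusionRule; omega
    have hbp : ¬ FusionRule p i p l := by unfold FusionRule; omega
    rcases Nat.eq_zero_or_pos j with rfl | hj0
    · rw [h0', if_neg hb0]
    rcases hj.eq_or_lt with rfl | hjp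
    · rw [hp, if_neg hbp]
    match i, ih with
    | 0, _ =>
      rw [h0, if_neg]
      unfold FusionRule; omega
    | 1, _ =>
      rw [h1 j hj0 hjp]
      refine if_congr ?_ rfl rfl
      unfold FusionRule Nat.ModEq
      omega
    | i + 2, ih =>
      -- Row `i + 2` is determined by the two preceding rows. The column `j + 1` may equal `p`,
      -- which is why the induction covers `j ≤ p`.
      have h := hrec (i + 1) j (by omega) (by omega) hj0 hjp
      have h' := fusionRule_recursion (i := i + 1) (by omega) (by omega) hj0 hjp hl hlp
      rw [ih (i + 1 - 1) (by omega) (by omega) hj, ih (i + 1) (by omega) (by omega) (by omega),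
        ih (i + 1) (by omega) (by omega) (by omega)] at h
      change N (i + 1 + 1) j = if FusionRule p (i + 1 + 1) j l then 1 else 0
      omega

end Fusion

/-! ### Multiplicities in `V_i ⊗ V_j` -/

section Multiplicities

variable (p : ℕ) (k : Type*) [Field k] [CharP k p]

lemma finrank_V {n : ℕ} (hn : 1 ≤ n) :
    Module.finrank k (MvPolynomial.homogeneousSubmodule (Fin 2) k (n - 1)) = n := by
  rw [finrank_homogeneousSubmodule]; omega

lemma cast_ne_zero_of_lt {n : ℕ} (hn : 1 ≤ n) (hnp : n < p) : (n : k) ≠ 0 := by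
  rw [Ne, CharP.cast_eq_zero_iff k p]
  exact Nat.not_dvd_of_pos_of_lt hn hnp

lemma pairingRank_tprod_comm (i j l : ℕ) :
    pairingRank (V p k l) ((V p k i).tprod (V p k j)) =
      pairingRank (V p k l) ((V p k j).tprod (V p k i)) :=
  pairingRank_congr _ (Representation.TensorProduct.comm _ _)

/-- The multiplicity of `V_l` in `V_i ⊗ V_j`, with the convention `V_0 = 0`. -/
noncomputable def fusionNumber (l i j : ℕ) : ℕ :=
  if i = 0 ∨ j = 0 then 0 else pairingRank (V p k l) ((V p k i).tprod (V p k j))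

lemma fusionNumber_of_pos (l : ℕ) {i j : ℕ} (hi : 1 ≤ i) (hj : 1 ≤ j) :
    fusionNumber p k l i j = pairingRank (V p k l) ((V p k i).tprod (V p k j)) :=
  if_neg (by omega)

lemma fusionNumber_comm (l i j : ℕ) : fusionNumber p k l i j = fusionNumber p k l j i := by
  unfold fusionNumber
  rw [pairingRank_tprod_comm]
  exact if_congr or_comm rfl rfl

/-- The additive group structure on a tensor product of spaces of forms, built over the monoid
structure that occurs in the tensor product of the `V`s. -/
noncomputable instance (priority := 2000) homTensorAddCommGroup (a b : ℕ) :
    AddCommGroup (MvPolynomial.homogeneousSubmodule (Fin 2) k a ⊗[k]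
      MvPolynomial.homogeneousSubmodule (Fin 2) k b) :=
  { TensorProduct.addCommMonoid, TensorProduct.addCommGroup with }

lemma pairingRank_two_tprod_tprod (l : ℕ) {i j : ℕ} (hi : 1 ≤ i) (hip : i < p) (hj : 1 ≤ j) :
    pairingRank (V p k l) (((V p k 2).tprod (V p k i)).tprod (V p k j)) =
      fusionNumber p k l (i + 1) j + fusionNumber p k l (i - 1) j := by
  -- For `i = 1` the product `V_2 ⊗ V_1` is just `V_2`; the missing summand is accounted for by the
  -- convention `V_0 = 0`.
  rcases hi.eq_or_lt with rfl | hi2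
  · rw [((Splitting.ofEquiv (Representation.TensorProduct.comm (V p k 2) (V p k 1))).rTensor
      (V p k j)).pairingRank_eq, Finset.univ_unique, Finset.sum_singleton,
      ((splittingOne p k 2).rTensor (V p k j)).pairingRank_eq, Finset.univ_unique,
      Finset.sum_singleton, fusionNumber_of_pos p k l (by omega) hj]
    simp [fusionNumber]
  · rw [(((splittingTwo p k hi2 (cast_ne_zero_of_lt p k hi hip)).rTensor (V p k j)).pairingRank_eq
      (V p k l)), Fin.sum_univ_two, fusionNumber_of_pos p k l (by omega) hj,
      fusionNumber_of_pos p k l (by omega) hj]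
    rfl

/-- Both sides count `V_l` in `V_2 ⊗ V_i ⊗ V_j`, with `V_2` absorbed first into `V_i` and then into
`V_j`. -/
lemma fusionNumber_recursion (l : ℕ) {i j : ℕ} (hi : 1 ≤ i) (hip : i < p) (hj : 1 ≤ j)
    (hjp : j < p) :
    fusionNumber p k l (i + 1) j + fusionNumber p k l (i - 1) j =
      fusionNumber p k l i (j + 1) + fusionNumber p k l i (j - 1) := by
  rw [← pairingRank_two_tprod_tprod p k l hi hip hj, fusionNumber_comm p k l i,
    fusionNumber_comm p k l i, ← pairingRank_two_tprod_tprod p k l hj hjp hi]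
  exact pairingRank_congr _ (tprodRightComm _ _ _)

variable [Fact p.Prime]

lemma pairingRank_V_V {j l : ℕ} (hj : 1 ≤ j) (hjp : j < p) (hl : 1 ≤ l) (hlp : l < p) :
    pairingRank (V p k l) (V p k j) = if j = l then 1 else 0 := by
  split_ifs with h
  · subst h
    exact (isBrick_V p k hj hjp.le).pairingRank_self
  · refine (isBrick_V p k hl hlp.le).pairingRank_of_isIndecomposable
      (isBrick_V p k hj hjp.le).isIndecomposable ?_
    rintro ⟨e⟩
    have := e.toLinearEquiv.finrank_eq
    rw [finrank_V k hl, finrank_V k hj] at this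
    exact h this.symm

/-- The Steinberg module `V_p` is a brick of dimension zero in `k`, so the trace argument applies;
it takes the place of projectivity. -/
lemma pairingRank_V_tprod_steinberg {l : ℕ} (hl : 1 ≤ l) (hlp : l < p) (i : ℕ) :
    pairingRank (V p k l) ((V p k i).tprod (V p k p)) = 0 := by
  have hp := (Fact.out : p.Prime).one_le
  rw [pairingRank_tprod_comm]
  refine (isBrick_V p k hl hlp.le).pairingRank_tprod_eq_zero ?_ (isBrick_V p k hp le_rfl) ?_ _
  · rw [finrank_V k hl]
    exact cast_ne_zero_of_lt p k hl hlp
  · rw [finrank_V k hp, CharP.cast_eq_zero]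

lemma pairingRank_V_tprod {i j l : ℕ} (hi : 1 ≤ i) (hip : i < p) (hj : 1 ≤ j) (hjp : j < p)
    (hl : 1 ≤ l) (hlp : l < p) :
    pairingRank (V p k l) ((V p k i).tprod (V p k j)) = if FusionRule p i j l then 1 else 0 := by
  rw [← fusionNumber_of_pos p k l hi hj]
  refine eq_fusionRule_of_recursion hl hlp (fusionNumber p k l) (fun j => if_pos (.inl rfl))
    (fun i => if_pos (.inr rfl)) (fun i => ?_) (fun j hj hjp => ?_)
    (fun i j hi hip hj hjp => fusionNumber_recursion p k l hi hip hj hjp) hip hjp.le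
  · unfold fusionNumber
    split_ifs
    · rfl
    · exact pairingRank_V_tprod_steinberg p k hl hlp i
  · rw [fusionNumber_of_pos p k l le_rfl hj, (splittingOne p k j).pairingRank_eq,
      Finset.univ_unique, Finset.sum_singleton, pairingRank_V_V p k hj hjp hl hlp]

lemma isSummand_V_tprod_iff {i j l : ℕ} (hi : 1 ≤ i) (hip : i < p) (hj : 1 ≤ j) (hjp : j < p)
    (hl : 1 ≤ l) (hlp : l < p) :
    IsSummand (V p k l) ((V p k i).tprod (V p k j)) ↔ FusionRule p i j l := by
  rw [(isBrick_V p k hl hlp.le).isSummand_iff, pairingRank_V_tprod p k hi hip hj hjp hl hlp]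
  simp

lemma multMatrix_apply {n : ℕ} (hn : 1 ≤ n) (hnp : n < p) (i j : Finset.Icc 1 (p - 1)) :
    multMatrix p k n i j = if FusionRule p i n j then 1 else 0 := by
  have hi := Finset.mem_Icc.1 i.2
  have hj := Finset.mem_Icc.1 j.2
  change summandMultiplicity _ _ = _
  rw [(isBrick_V p k hj.1 (by omega)).summandMultiplicity_eq,
    pairingRank_V_tprod p k hi.1 (by omega) hn hnp hj.1 (by omega)]

end Multiplicities

end SL2Mod

theorem lemma4p2 (p : ℕ) [Fact p.Prime] (k : Type*) [Field k] [IsAlgClosed k] [CharP k p] :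
    (∀ i j l : ℕ, 1 ≤ i → i ≤ p - 1 → 1 ≤ j → j ≤ p - 1 → 1 ≤ l → l ≤ p - 1 →
      List.TFAE [
        SL2Mod.IsSummand (SL2Mod.V p k l) ((SL2Mod.V p k i).tprod (SL2Mod.V p k j)),
        SL2Mod.IsSummand (SL2Mod.V p k i) ((SL2Mod.V p k j).tprod (SL2Mod.V p k l)),
        SL2Mod.IsSummand (SL2Mod.V p k j) ((SL2Mod.V p k l).tprod (SL2Mod.V p k i)),
        i + j + l ≡ 1 [MOD 2] ∧ i + j + l < 2 * p ∧ l < i + j ∧ i < j + l ∧ j < l + i]) ∧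
    (∀ n : ℕ, 1 ≤ n → n ≤ p - 1 → (SL2Mod.multMatrix p k n).IsSymm) := by
  have hp := (Fact.out : p.Prime).one_le
  constructor
  · intro i j l hi hip hj hjp hl hlp
    rw [SL2Mod.isSummand_V_tprod_iff p k hi (by omega) hj (by omega) hl (by omega),
      SL2Mod.isSummand_V_tprod_iff p k hj (by omega) hl (by omega) hi (by omega),
      SL2Mod.isSummand_V_tprod_iff p k hl (by omega) hi (by omega) hj (by omega)]
    -- The three summand conditions become the fusion rule at cyclic permutations of `i, j, l`,
    -- under which it is invariant.
    have h1 : SL2Mod.FusionRule p j l i ↔ SL2Mod.FusionRule p i j l := by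
      unfold SL2Mod.FusionRule Nat.ModEq; omega
    have h2 : SL2Mod.FusionRule p l i j ↔ SL2Mod.FusionRule p i j l := by
      unfold SL2Mod.FusionRule Nat.ModEq; omega
    rw [h1, h2]
    change List.TFAE [_, _, _, SL2Mod.FusionRule p i j l]
    simpa [List.TFAE] using fun x hx y hy => Iff.trans hx (Iff.symm hy)
  · intro n hn hnp
    refine Matrix.IsSymm.ext fun i j => ?_
    rw [SL2Mod.multMatrix_apply p k hn (by omega), SL2Mod.multMatrix_apply p k hn (by omega)]
    refine if_congr ?_ rfl rfl
    unfold SL2Mod.FusionRule Nat.ModEq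
    omega
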